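/- Let $D$ be an integral domain with quotient field $K$. For a nonzero fractional ideal $I$ of $D$ put $I^{-1}=\{x\in K : xI\subseteq D\}$, $I_v=(I^{-1})^{-1}$ and $I_t=\bigcup J_v$, where $J$ ranges over the nonzero finitely generated fractional ideals contained in $I$; $I$ is called divisorial if $I_v=I$. The domain $D$ is called a $v$-domain (respectively, a Prüfer $v$-multiplication domain, PVMD) if $(II^{-1})_v=D$ (respectively, $(II^{-1})_t=D$) for every nonzero finitely generated fractional ideal $I$ of $D$, and it is called completely integrally closed if every $x\in K$ for which there is a nonzero $r\in D$ with $rx^n\in D$ for all integers $n\ge 1$ lies in $D$. An essential discrete rank-one valuation domain of $D$ is a discrete rank-one valuation domain of the form $D_P$ for some prime ideal $P$ of $D$. Intersections of overrings are taken inside $K$, the intersection of the empty family being $K$. **Theorem.** Suppose that $D=\bigcap_{P\in F}D_P$ for some set $F$ of (nonzero) divisorial prime ideals of $D$, and that the power series ring $D[[X]]$ is a PVMD. Then $D$ is a $v$-domain, $D$ is an intersection of essential discrete rank-one valuation domains of $D$, and $D$ is completely integrally closed. -/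

import Mathlib

open scoped nonZeroDivisors

section StarOperations

/-- The `v`-closure `I_v = (I⁻¹)⁻¹` of a fractional ideal `I` of the domain `D`, where
`I⁻¹ = {x ∈ K | x I ⊆ D}` and `K` is the quotient field of `D`. -/
noncomputable def vClosure {D : Type*} [CommRing D] [IsDomain D]
    (I : FractionalIdeal D⁰ (FractionRing D)) : FractionalIdeal D⁰ (FractionRing D) :=
  (I⁻¹)⁻¹

/-- The `t`-closure of a nonzero fractional ideal `I`, as a subset of `K`: the union of the `J_v`,
where `J` ranges over the nonzero finitely generated fractional ideals contained in `I`. -/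
def tClosure {D : Type*} [CommRing D] [IsDomain D]
    (I : FractionalIdeal D⁰ (FractionRing D)) : Set (FractionRing D) :=
  {x | ∃ J : FractionalIdeal D⁰ (FractionRing D),
    J ≠ 0 ∧ (J : Submodule D (FractionRing D)).FG ∧ J ≤ I ∧ x ∈ vClosure J}

/-- A fractional ideal is divisorial (a `v`-ideal) if it is nonzero and `I_v = I`. -/
def IsDivisorial {D : Type*} [CommRing D] [IsDomain D]
    (I : FractionalIdeal D⁰ (FractionRing D)) : Prop :=
  I ≠ 0 ∧ vClosure I = I

/-- `I` is `v`-invertible if `(I I⁻¹)_v = D`. -/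
def IsVInvertible {D : Type*} [CommRing D] [IsDomain D]
    (I : FractionalIdeal D⁰ (FractionRing D)) : Prop :=
  vClosure (I * I⁻¹) = 1

/-- `I` is `t`-invertible if `(I I⁻¹)_t = D` (an equality of subsets of `K`). -/
def IsTInvertible {D : Type*} [CommRing D] [IsDomain D]
    (I : FractionalIdeal D⁰ (FractionRing D)) : Prop :=
  tClosure (I * I⁻¹) = Set.range (algebraMap D (FractionRing D))

/-- `D` is a `v`-domain: every nonzero finitely generated fractional ideal is `v`-invertible. -/
def IsVDomain (D : Type*) [CommRing D] [IsDomain D] : Prop :=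
  ∀ I : FractionalIdeal D⁰ (FractionRing D),
    I ≠ 0 → (I : Submodule D (FractionRing D)).FG → IsVInvertible I

/-- `D` is a Prüfer `v`-multiplication domain: every nonzero finitely generated fractional ideal
is `t`-invertible. -/
def IsPVMD (D : Type*) [CommRing D] [IsDomain D] : Prop :=
  ∀ I : FractionalIdeal D⁰ (FractionRing D),
    I ≠ 0 → (I : Submodule D (FractionRing D)).FG → IsTInvertible I

end StarOperations

section Localizations

/-- The localization `D_P`, as a subring of the quotient field of `D` containing `D`. -/
noncomputable def localizationAt {D : Type*} [CommRing D] [IsDomain D] (P : PrimeSpectrum D) :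
    Subalgebra D (FractionRing D) :=
  Localization.subalgebra.ofField (FractionRing D) P.asIdeal.primeCompl
    P.asIdeal.primeCompl_le_nonZeroDivisors

/-- `D` is an intersection of localizations at divisorial prime ideals. The infimum is taken among
the `D`-subalgebras of the quotient field `K`; for the empty family it is `K`. -/
def IsIntersectionOfLocalizationsAtDivisorialPrimes (D : Type*) [CommRing D] [IsDomain D] : Prop :=
  ∃ F : Set (PrimeSpectrum D),
    (∀ P ∈ F, IsDivisorial (P.asIdeal : FractionalIdeal D⁰ (FractionRing D))) ∧
      ⨅ P ∈ F, localizationAt P = ⊥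

/-- An overring `V` of `D` is an essential discrete rank-one valuation domain if it is a discrete
valuation ring and `V = D_P` for some prime ideal `P` of `D`. -/
def IsEssentialDVR {D : Type*} [CommRing D] [IsDomain D] (V : Subalgebra D (FractionRing D)) :
    Prop :=
  IsDiscreteValuationRing V ∧ ∃ P : PrimeSpectrum D, V = localizationAt P

/-- `D` is an intersection of essential discrete rank-one valuation overrings. -/
def IsIntersectionOfEssentialDVRs (D : Type*) [CommRing D] [IsDomain D] : Prop :=
  ∃ G : Set (Subalgebra D (FractionRing D)), (∀ V ∈ G, IsEssentialDVR V) ∧ sInf G = ⊥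

/-- `D` is completely integrally closed: each `x ∈ K` for which there is a nonzero `r ∈ D` with
`r x ^ n ∈ D` for all `n` lies in `D`. -/
def IsCompletelyIntegrallyClosed (D : Type*) [CommRing D] [IsDomain D] : Prop :=
  completeIntegralClosure D (FractionRing D) = ⊥

end Localizations

/-! For a divisorial prime `P` of `D`, the prime `P[[X]]` is divisorial in the PVMD `D[[X]]`, so
divisibility is totally ordered in the localization there. Comparing constants shows that `D_P` is a
valuation domain. It is also archimedean: if `a ≠ 0` were divisible by all powers of a nonunit `p`,
the series with coefficients `a / p ^ i ^ 2` (up to units) could not be compared with the constant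
`a`, because the quadratic exponents force the coefficients of a multiplier to be divisible by all
powers of `p`. An intersection of archimedean valuation domains is completely integrally closed, and
such a domain is a `v`-domain. Finally, `P` being divisorial gives `x ∈ P⁻¹` outside `D_P`, and `1 /
x` generates the maximal ideal of `D_P`, which is therefore a DVR. -/

/-- The prime ideal `P[[X]]` of power series all of whose coefficients lie in `P`. -/
noncomputable def coeffIdeal {D : Type*} [CommRing D] (P : Ideal D) : Ideal (PowerSeries D) :=
  RingHom.ker (PowerSeries.map (Ideal.Quotient.mk P))

theorem mem_coeffIdeal {D : Type*} [CommRing D] {P : Ideal D} {f : PowerSeries D} :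
    f ∈ coeffIdeal P ↔ ∀ n, PowerSeries.coeff n f ∈ P := by
  simp [coeffIdeal, RingHom.mem_ker, PowerSeries.ext_iff, Ideal.Quotient.eq_zero_iff_mem]

instance coeffIdeal_isPrime {D : Type*} [CommRing D] (P : Ideal D) [P.IsPrime] :
    (coeffIdeal P).IsPrime :=
  RingHom.ker_isPrime _

/-! ### Inverses, divisoriality and power series. -/

theorem le_vClosure {D : Type*} [CommRing D] [IsDomain D]
    {I : FractionalIdeal D⁰ (FractionRing D)} (h0 : I ≠ 0) (hI : I⁻¹ ≠ 0) : I ≤ vClosure I := by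
  intro x hx
  rw [vClosure, FractionalIdeal.mem_inv_iff hI]
  intro y hy
  rw [mul_comm]
  exact (FractionalIdeal.mem_inv_iff h0).1 hy x hx

theorem one_mem_inv_of_le_one {D : Type*} [CommRing D] [IsDomain D]
    {I : FractionalIdeal D⁰ (FractionRing D)} (h0 : I ≠ 0) (h1 : I ≤ 1) : 1 ∈ I⁻¹ := by
  rw [FractionalIdeal.mem_inv_iff h0]
  intro y hy
  rw [one_mul]
  exact h1 hy

theorem inv_ne_zero_of_ne_zero {D : Type*} [CommRing D] [IsDomain D]
    {I : FractionalIdeal D⁰ (FractionRing D)} (h : I ≠ 0) : I⁻¹ ≠ 0 := by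
  intro h'
  have := FractionalIdeal.bot_lt_mul_inv h
  rw [h', mul_zero] at this
  exact lt_irrefl _ this

/-- A fraction `a / b` in `P⁻¹` also lies in the inverse of `P[[X]]`, by dividing coefficientwise.
Hence it carries every coefficient of an `f` in the `v`-closure into `D`, so these coefficients lie
in `P_v = P`. -/
theorem isDivisorial_coeffIdeal {D : Type*} [CommRing D] [IsDomain D] {P : Ideal D}
    (hP : IsDivisorial (P : FractionalIdeal D⁰ (FractionRing D))) :
    IsDivisorial (coeffIdeal P : FractionalIdeal (PowerSeries D)⁰
      (FractionRing (PowerSeries D))) := by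
  obtain ⟨hP0, hPv⟩ := hP
  have hQ0 : (coeffIdeal P : FractionalIdeal (PowerSeries D)⁰
      (FractionRing (PowerSeries D))) ≠ 0 := by
    rw [FractionalIdeal.coeIdeal_ne_zero]
    obtain ⟨p, hp, hp0⟩ := Submodule.exists_mem_ne_zero_of_ne_bot
      (FractionalIdeal.coeIdeal_ne_zero.1 hP0)
    refine Submodule.ne_bot_iff _ |>.2 ⟨PowerSeries.C p, mem_coeffIdeal.2 fun n ↦ ?_,
      (map_ne_zero_iff _ PowerSeries.C_injective).2 hp0⟩
    rw [PowerSeries.coeff_C]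
    split_ifs <;> simp [hp]
  have hQi := inv_ne_zero_of_ne_zero hQ0
  have hPi : (P : FractionalIdeal D⁰ (FractionRing D))⁻¹ ≠ 0 := inv_ne_zero_of_ne_zero hP0
  refine ⟨hQ0, le_antisymm ?_ (le_vClosure hQ0 hQi)⟩
  intro f hf
  have h1 := (FractionalIdeal.mem_inv_iff hQi).1 hf 1
    (one_mem_inv_of_le_one hQ0 FractionalIdeal.coeIdeal_le_one)
  rw [mul_one] at h1
  obtain ⟨f, rfl⟩ := (FractionalIdeal.mem_one_iff _).1 h1
  refine FractionalIdeal.mem_coeIdeal_of_mem _ (mem_coeffIdeal.2 fun n ↦ ?_)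
  have : algebraMap D (FractionRing D) (PowerSeries.coeff n f) ∈
      (P : FractionalIdeal D⁰ (FractionRing D)) := by
    rw [← hPv, vClosure, FractionalIdeal.mem_inv_iff hPi]
    intro x hx
    obtain ⟨a, b, hb, rfl⟩ := IsFractionRing.div_surjective (A := D) x
    have hb0 : b ≠ 0 := nonZeroDivisors.ne_zero hb
    have hbK : algebraMap D (FractionRing D) b ≠ 0 := by simpa using hb0
    have hbL : algebraMap (PowerSeries D) (FractionRing (PowerSeries D)) (PowerSeries.C b) ≠ 0 := by
      simpa using (map_ne_zero_iff _ PowerSeries.C_injective).2 hb0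
    have hdvd : ∀ p ∈ P, b ∣ a * p := by
      intro p hp
      obtain ⟨c, hc⟩ := (FractionalIdeal.mem_one_iff _).1
        ((FractionalIdeal.mem_inv_iff hP0).1 hx _ (FractionalIdeal.mem_coeIdeal_of_mem _ hp))
      refine ⟨c, IsFractionRing.injective D (FractionRing D) ?_⟩
      rw [map_mul, map_mul, hc]
      field_simp
    have hy : algebraMap (PowerSeries D) (FractionRing (PowerSeries D)) (PowerSeries.C a) /
        algebraMap (PowerSeries D) (FractionRing (PowerSeries D)) (PowerSeries.C b) ∈
        (coeffIdeal P : FractionalIdeal (PowerSeries D)⁰ (FractionRing (PowerSeries D)))⁻¹ := by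
      rw [FractionalIdeal.mem_inv_iff hQ0]
      intro y hy
      obtain ⟨g, hg, rfl⟩ := (FractionalIdeal.mem_coeIdeal _).1 hy
      choose c hc using fun n ↦ hdvd _ (mem_coeffIdeal.1 hg n)
      refine (FractionalIdeal.mem_one_iff _).2 ⟨PowerSeries.mk c, ?_⟩
      have : PowerSeries.C a * g = PowerSeries.C b * PowerSeries.mk c := by
        ext n
        simp [hc]
      rw [div_mul_eq_mul_div, eq_div_iff hbL, ← map_mul, ← map_mul, this, mul_comm]
    obtain ⟨h, hh⟩ := (FractionalIdeal.mem_one_iff _).1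
      ((FractionalIdeal.mem_inv_iff hQi).1 hf _ hy)
    have hh' : PowerSeries.C b * h = PowerSeries.C a * f := by
      apply IsFractionRing.injective (PowerSeries D) (FractionRing (PowerSeries D))
      rw [map_mul, map_mul, hh]
      field_simp
    have hn := congrArg (PowerSeries.coeff n) hh'
    simp only [PowerSeries.coeff_C_mul] at hn
    refine (FractionalIdeal.mem_one_iff _).2 ⟨PowerSeries.coeff n h, ?_⟩
    rw [mul_div_assoc', eq_div_iff hbK, ← map_mul, ← map_mul, mul_comm, hn, mul_comm]
  obtain ⟨c, hc, hc'⟩ := (FractionalIdeal.mem_coeIdeal _).1 this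
  rwa [← IsFractionRing.injective D (FractionRing D) hc']

/-! ### Divisibility at divisorial primes. -/

/-- In a PVMD, the localization at a divisorial prime has totally ordered divisibility. -/
theorem IsPVMD.exists_mul_eq_mul {R : Type*} [CommRing R] [IsDomain R] (hR : IsPVMD R)
    {Q : Ideal R} [hQp : Q.IsPrime]
    (hQ : IsDivisorial (Q : FractionalIdeal R⁰ (FractionRing R))) (a b : R) :
    ∃ s ∉ Q, ∃ r, s * a = r * b ∨ s * b = r * a := by
  have h1Q : (1 : R) ∉ Q := (Ideal.ne_top_iff_one Q).1 hQp.ne_top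
  by_cases ha : a = 0
  · exact ⟨1, h1Q, 0, Or.inl (by simp [ha])⟩
  set I : FractionalIdeal R⁰ (FractionRing R) :=
    ((Ideal.span {a, b} : Ideal R) : FractionalIdeal R⁰ (FractionRing R)) with hI
  have hI0 : I ≠ 0 := by
    rw [hI, FractionalIdeal.coeIdeal_ne_zero]
    exact Submodule.ne_bot_iff _ |>.2 ⟨a, Ideal.subset_span (by simp), ha⟩
  have hfg : (I : Submodule R (FractionRing R)).FG := by
    rw [hI, FractionalIdeal.coe_coeIdeal]
    exact (Submodule.fg_span (Set.toFinite _)).map _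
  have ht := hR I hI0 hfg
  have hone : (1 : FractionRing R) ∈ tClosure (I * I⁻¹) := by
    rw [ht]
    exact ⟨1, map_one _⟩
  obtain ⟨J, hJ0, -, hJI, hJv⟩ := hone
  -- Otherwise `1 ∈ J_v ⊆ Q_v = Q`.
  have hJQ : ¬ J ≤ Q := by
    intro hle
    have hmono : vClosure J ≤ vClosure (Q : FractionalIdeal R⁰ (FractionRing R)) :=
      FractionalIdeal.inv_anti_mono (inv_ne_zero_of_ne_zero hQ.1) (inv_ne_zero_of_ne_zero hJ0)
        (FractionalIdeal.inv_anti_mono hJ0 hQ.1 hle)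
    have h1 := hmono hJv
    rw [hQ.2] at h1
    obtain ⟨c, hc, hc'⟩ := (FractionalIdeal.mem_coeIdeal _).1 h1
    rw [← map_one (algebraMap R (FractionRing R))] at hc'
    exact h1Q (IsFractionRing.injective R (FractionRing R) hc' ▸ hc)
  -- For `y ∈ I⁻¹`, the elements `α = y a` and `β = y b` satisfy `α b = β a`. If `a` and `b` are not
  -- comparable at `Q`, both lie in `Q`, whence `J ≤ I I⁻¹ ≤ Q`.
  by_contra! hcon
  refine hJQ (hJI.trans (FractionalIdeal.mul_le.2 fun i hi y hy ↦ ?_))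
  obtain ⟨c, hc, rfl⟩ := (FractionalIdeal.mem_coeIdeal _).1 hi
  obtain ⟨u, v, rfl⟩ := Ideal.mem_span_pair.1 hc
  have hmem := (FractionalIdeal.mem_inv_iff hI0).1 hy
  obtain ⟨α, hα⟩ := (FractionalIdeal.mem_one_iff _).1 (hmem _
    (FractionalIdeal.mem_coeIdeal_of_mem _ (Ideal.subset_span (Set.mem_insert a {b}))))
  obtain ⟨β, hβ⟩ := (FractionalIdeal.mem_one_iff _).1 (hmem (algebraMap R _ b)
    (FractionalIdeal.mem_coeIdeal_of_mem _ (Ideal.subset_span (by simp))))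
  have hab : α * b = β * a := by
    apply IsFractionRing.injective R (FractionRing R)
    rw [map_mul, map_mul, hα, hβ]
    ring
  have hαQ : α ∈ Q := by
    by_contra h
    exact (hcon α h β).2 hab
  have hβQ : β ∈ Q := by
    by_contra h
    exact (hcon β h α).1 hab.symm
  refine (FractionalIdeal.mem_coeIdeal _).2
    ⟨u * α + v * β, Q.add_mem (Q.mul_mem_left _ hαQ) (Q.mul_mem_left _ hβQ), ?_⟩
  simp only [map_add, map_mul, hα, hβ]
  ring

/-- If `γ i` has the value of `α / p ^ i ^ 2`, then a power series `u` for which `α` divides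
`u * ∑ γ i X ^ i` has coefficients divisible by all powers of `p`. -/
theorem pow_dvd_coeff_of_mul_mk_eq {V : Type*} [CommRing V] [IsDomain V] {p α : V} (hα : α ≠ 0)
    {γ : ℕ → V} {e : ℕ → Vˣ} (hγ : ∀ i, γ i * p ^ i ^ 2 = e i * α) {u w : PowerSeries V}
    (h : u * PowerSeries.mk γ = PowerSeries.C α * w) (k m : ℕ) :
    p ^ m ∣ PowerSeries.coeff k u := by
  induction k using Nat.strong_induction_on generalizing m with
  | _ k ih =>
  rcases Nat.eq_zero_or_pos m with rfl | hm
  · simp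
  obtain ⟨l, rfl⟩ := Nat.exists_eq_succ_of_ne_zero hm.ne'
  -- In degree `k + (l + 1)`, the scaling turns the term `(k, l + 1)` into `α` times `coeff k u`, up
  -- to a unit. All other terms will be divisible by `α p ^ (l + 1)`.
  have hc := congrArg (fun f ↦ p ^ (l + 1) ^ 2 * PowerSeries.coeff (k + (l + 1)) f) h
  simp only [PowerSeries.coeff_C_mul] at hc
  simp only [PowerSeries.coeff_mul, PowerSeries.coeff_mk, Finset.mul_sum] at hc
  have hle : l + 1 ≤ (l + 1) ^ 2 := Nat.le_self_pow (by norm_num) _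
  have hmem : (k, l + 1) ∈ Finset.HasAntidiagonal.antidiagonal (k + (l + 1)) := by simp
  rw [← Finset.add_sum_erase _ _ hmem] at hc
  have hsum : α * p ^ (l + 1) ∣ ∑ x ∈ (Finset.HasAntidiagonal.antidiagonal (k + (l + 1))).erase (k, l + 1),
      p ^ (l + 1) ^ 2 * (PowerSeries.coeff x.1 u * γ x.2) := by
    refine Finset.dvd_sum fun ⟨i, j⟩ hx ↦ ?_
    simp only [Finset.mem_erase, Finset.HasAntidiagonal.mem_antidiagonal, ne_eq, Prod.mk.injEq] at hx
    -- For `i < k` induction supplies enough powers of `p` to absorb `j ^ 2`. For `i > k` the gap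
    -- between squares suffices: `(l + 1) ^ 2 - j ^ 2 ≥ 2 * l + 1`.
    rcases lt_or_ge i k with hi | hi
    · obtain ⟨y, hy⟩ := ih i hi (j ^ 2 + (l + 1))
      refine ⟨p ^ (l + 1) ^ 2 * y * e j, ?_⟩
      simp only [hy]
      linear_combination p ^ (l + 1) ^ 2 * p ^ (l + 1) * y * hγ j
    · have hj : j ≤ l := by omega
      obtain ⟨c, hc⟩ := Nat.exists_eq_add_of_le
        (show j ^ 2 + (l + 1) ≤ (l + 1) ^ 2 by nlinarith)
      refine ⟨p ^ c * PowerSeries.coeff i u * e j, ?_⟩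
      simp only [hc, pow_add p (j ^ 2 + (l + 1)) c, pow_add p (j ^ 2) (l + 1)]
      linear_combination p ^ (l + 1) * p ^ c * PowerSeries.coeff i u * hγ j
  have hrhs : α * p ^ (l + 1) ∣
      p ^ (l + 1) ^ 2 * (α * PowerSeries.coeff (k + (l + 1)) w) := by
    rw [mul_left_comm]
    exact mul_dvd_mul_left _ (Dvd.dvd.mul_right (pow_dvd_pow _ hle) _)
  rw [← hc, dvd_add_left hsum] at hrhs
  have hk : p ^ (l + 1) ^ 2 * (PowerSeries.coeff k u * γ (l + 1)) =
      α * (PowerSeries.coeff k u * e (l + 1)) := by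
    linear_combination PowerSeries.coeff k u * hγ (l + 1)
  rw [hk, mul_dvd_mul_iff_left hα] at hrhs
  exact (Units.dvd_mul_right).1 hrhs

section AtPrime

variable {D V : Type*} [CommRing D] [CommRing V] [Algebra D V] (P : Ideal D) [P.IsPrime]
  [IsLocalization.AtPrime V P]

theorem exists_associated_algebraMap {D V : Type*} [CommRing D] [CommRing V] [Algebra D V]
    (P : Ideal D) [P.IsPrime] [IsLocalization.AtPrime V P] (x : V) : ∃ d : D, Associated (algebraMap D V d) x := by
  obtain ⟨d, s, rfl⟩ := IsLocalization.exists_mk'_eq P.primeCompl x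
  refine ⟨d, Associated.symm ⟨(IsLocalization.map_units V s).unit, ?_⟩⟩
  simp

theorem mem_of_dvd_algebraMap {p : V} (hp : ¬ IsUnit p) {d : D} (h : p ∣ algebraMap D V d) :
    d ∈ P := by
  by_contra hd
  exact hp (isUnit_of_dvd_unit h (IsLocalization.map_units V (⟨d, hd⟩ : P.primeCompl)))

/-- Some coefficient of `s` is a unit of `V`; the coefficients in that degree compare the two
constants. -/
theorem dvd_or_dvd_of_coeffIdeal
    (h : ∀ f g : PowerSeries D, ∃ s ∉ coeffIdeal P, ∃ r, s * f = r * g ∨ s * g = r * f)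
    (x y : V) : x ∣ y ∨ y ∣ x := by
  obtain ⟨a, ha⟩ := exists_associated_algebraMap P x
  obtain ⟨b, hb⟩ := exists_associated_algebraMap P y
  rw [← ha.dvd_iff_dvd_left, ← ha.dvd_iff_dvd_right, ← hb.dvd_iff_dvd_left,
    ← hb.dvd_iff_dvd_right]
  obtain ⟨s, hs, r, hr⟩ := h (PowerSeries.C a) (PowerSeries.C b)
  obtain ⟨n, hn⟩ := not_forall.1 (mt mem_coeffIdeal.2 hs)
  have hu : IsUnit (algebraMap D V (PowerSeries.coeff n s)) :=
    IsLocalization.map_units V (⟨_, hn⟩ : P.primeCompl)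
  rcases hr with hr | hr
  · right
    have := congrArg (fun f ↦ algebraMap D V (PowerSeries.coeff n f)) hr
    simp only [PowerSeries.coeff_mul_C, map_mul] at this
    exact (hu.dvd_mul_left).1 (this ▸ dvd_mul_left _ _)
  · left
    have := congrArg (fun f ↦ algebraMap D V (PowerSeries.coeff n f)) hr
    simp only [PowerSeries.coeff_mul_C, map_mul] at this
    exact (hu.dvd_mul_left).1 (this ▸ dvd_mul_left _ _)

theorem eq_zero_of_forall_pow_dvd_of_coeffIdeal [IsDomain V]
    (h : ∀ f g : PowerSeries D, ∃ s ∉ coeffIdeal P, ∃ r, s * f = r * g ∨ s * g = r * f)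
    {p x : V} (hp : ¬ IsUnit p) (hx : ∀ n, p ^ n ∣ x) : x = 0 := by
  by_contra hx0
  obtain ⟨a, ha⟩ := exists_associated_algebraMap P x
  have ha0 : algebraMap D V a ≠ 0 := ha.ne_zero_iff.2 hx0
  choose c hc using hx
  choose g hg using fun i : ℕ ↦ exists_associated_algebraMap P (c (i ^ 2))
  have hassoc : ∀ i, Associated (algebraMap D V a) (algebraMap D V (g i) * p ^ i ^ 2) := by
    intro i
    refine ha.trans ?_
    rw [hc (i ^ 2), mul_comm]
    exact (hg i).symm.mul_right _
  choose e he using hassoc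
  have hγ : ∀ i, algebraMap D V (g i) * p ^ i ^ 2 = e i * algebraMap D V a := fun i ↦ by
    rw [← he, mul_comm]
  obtain ⟨s, hs, r, hr⟩ := h (PowerSeries.mk g) (PowerSeries.C a)
  obtain ⟨k, hk⟩ := not_forall.1 (mt mem_coeffIdeal.2 hs)
  have hmap : PowerSeries.map (algebraMap D V) (PowerSeries.mk g) =
      PowerSeries.mk fun i ↦ algebraMap D V (g i) := by
    ext
    simp
  apply hk
  refine mem_of_dvd_algebraMap P hp ?_
  -- The multiplier of the series is `s` in the first case, `r` in the second. In the latter, `r`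
  -- absorbs the denominators, so `a * p` divides the coefficients of `s * a`.
  rcases hr with hr | hr
  · have hr' := congrArg (PowerSeries.map (algebraMap D V)) hr
    rw [map_mul, map_mul, PowerSeries.map_C, hmap, mul_comm (PowerSeries.map _ r)] at hr'
    simpa using pow_dvd_coeff_of_mul_mk_eq ha0 hγ hr' k 1
  · have hr' := congrArg (PowerSeries.map (algebraMap D V)) hr
    rw [map_mul, map_mul, PowerSeries.map_C, hmap, mul_comm (PowerSeries.map _ s)] at hr'
    have hk' := congrArg (PowerSeries.coeff k) hr'
    rw [PowerSeries.coeff_C_mul] at hk'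
    simp only [PowerSeries.coeff_mul, PowerSeries.coeff_mk] at hk'
    have hdvd : algebraMap D V a * p ∣ algebraMap D V a *
        PowerSeries.coeff k (PowerSeries.map (algebraMap D V) s) := by
      rw [hk']
      refine Finset.dvd_sum fun ⟨i, j⟩ _ ↦ ?_
      obtain ⟨y, hy⟩ := pow_dvd_coeff_of_mul_mk_eq ha0 hγ hr'.symm i (j ^ 2 + 1)
      refine ⟨y * e j, ?_⟩
      simp only [hy]
      linear_combination p * y * hγ j
    rw [mul_dvd_mul_iff_left ha0] at hdvd
    simpa using hdvd

end AtPrime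

/-! ### Complete integral closure and `v`-domains. -/

instance localizationAt_isLocalization {D : Type*} [CommRing D] [IsDomain D]
    (P : PrimeSpectrum D) : IsLocalization.AtPrime (localizationAt P) P.asIdeal :=
  Localization.subalgebra.isLocalization_ofField _ _ _

/-- An element of the quotient field outside a subring with totally ordered divisibility is the
inverse of a nonunit. -/
theorem exists_mul_eq_one_of_notMem {D : Type*} [CommRing D] [IsDomain D]
    {V : Subalgebra D (FractionRing D)} (hV : ∀ x y : V, x ∣ y ∨ y ∣ x) {x : FractionRing D}
    (hx : x ∉ V) : ∃ y : V, ¬ IsUnit y ∧ (y : FractionRing D) * x = 1 := by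
  obtain ⟨a, b, hb, rfl⟩ := IsFractionRing.div_surjective (A := D) x
  have hb0 : algebraMap D (FractionRing D) b ≠ 0 := by simpa using nonZeroDivisors.ne_zero hb
  have ha0 : algebraMap D (FractionRing D) a ≠ 0 := by
    intro h
    rw [h, zero_div] at hx
    exact hx V.zero_mem
  rcases hV (algebraMap D V a) (algebraMap D V b) with ⟨c, hc⟩ | ⟨c, hc⟩
  · have hc' : algebraMap D (FractionRing D) b = algebraMap D (FractionRing D) a * c :=
      congrArg Subtype.val hc
    have h1 : (c : FractionRing D) *
        (algebraMap D (FractionRing D) a / algebraMap D (FractionRing D) b) = 1 := by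
      rw [mul_div_assoc', div_eq_one_iff_eq hb0, hc', mul_comm]
    refine ⟨c, fun hu ↦ hx ?_, h1⟩
    obtain ⟨d, hd⟩ := hu.exists_left_inv
    have hd' : (d : FractionRing D) * c = 1 := congrArg Subtype.val hd
    have : algebraMap D (FractionRing D) a / algebraMap D (FractionRing D) b = d := by
      rw [← one_mul (_ / _), ← hd', mul_assoc, h1, mul_one]
    rw [this]
    exact d.2
  · exfalso
    apply hx
    have hc' : algebraMap D (FractionRing D) a = algebraMap D (FractionRing D) b * c :=
      congrArg Subtype.val hc
    rw [hc', mul_div_cancel_left₀ _ hb0]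
    exact c.2

/-- A subring of the quotient field with totally ordered divisibility and archimedean value group
is completely integrally closed. -/
theorem mem_of_isAlmostIntegral {D : Type*} [CommRing D] [IsDomain D]
    {V : Subalgebra D (FractionRing D)} (hV : ∀ x y : V, x ∣ y ∨ y ∣ x)
    (harch : ∀ p x : V, ¬ IsUnit p → (∀ n, p ^ n ∣ x) → x = 0) {x : FractionRing D}
    (hx : IsAlmostIntegral D x) : x ∈ V := by
  by_contra hxV
  obtain ⟨y, hyu, hyx⟩ := exists_mul_eq_one_of_notMem hV hxV
  obtain ⟨r, hr, hrx⟩ := hx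
  have hr0 : algebraMap D V r ≠ 0 := fun h ↦ nonZeroDivisors.ne_zero hr
    (IsFractionRing.injective D (FractionRing D) (by simpa using congrArg Subtype.val h))
  -- With `y = 1 / x`, one has `r = y ^ n * (r x ^ n)`, so every power of `y` divides `r`.
  refine hr0 (harch y _ hyu fun n ↦ ?_)
  obtain ⟨d, hd⟩ := hrx n
  refine ⟨algebraMap D V d, Subtype.ext ?_⟩
  change algebraMap D (FractionRing D) r = (y : FractionRing D) ^ n * algebraMap D _ d
  rw [hd, Algebra.smul_def, mul_left_comm, ← mul_pow, hyx, one_pow, mul_one]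

/-- An `x` in `(I I⁻¹)⁻¹` maps `I⁻¹` into itself, hence so do its powers. A nonzero product `i j`
from `I I⁻¹` is then a common denominator, making `x` almost integral. -/
theorem IsCompletelyIntegrallyClosed.isVDomain {D : Type*} [CommRing D] [IsDomain D]
    (hD : IsCompletelyIntegrallyClosed D) : IsVDomain D := by
  intro I hI0 _
  have hIi := inv_ne_zero_of_ne_zero hI0
  have hle : I * I⁻¹ ≤ 1 := FractionalIdeal.mul_le.2 fun i hi j hj ↦ by
    rw [mul_comm]
    exact (FractionalIdeal.mem_inv_iff hI0).1 hj i hi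
  have hII0 : I * I⁻¹ ≠ 0 := (FractionalIdeal.bot_lt_mul_inv hI0).ne'
  have key : (I * I⁻¹)⁻¹ = 1 := by
    refine le_antisymm (fun x hx ↦ ?_) ?_
    · have hmul : ∀ y ∈ I⁻¹, x * y ∈ I⁻¹ := by
        intro y hy
        rw [FractionalIdeal.mem_inv_iff hI0]
        intro z hz
        rw [mul_assoc, mul_comm y]
        exact (FractionalIdeal.mem_inv_iff hII0).1 hx _ (FractionalIdeal.mul_mem_mul hz hy)
      have hpow : ∀ n, ∀ y ∈ I⁻¹, x ^ n * y ∈ I⁻¹ := by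
        intro n
        induction n with
        | zero => simp
        | succ n ih =>
          intro y hy
          rw [pow_succ', mul_assoc]
          exact hmul _ (ih y hy)
      obtain ⟨i, hi, hi0⟩ : ∃ z ∈ I, z ≠ 0 := by
        by_contra! h
        exact hI0 (FractionalIdeal.eq_zero_iff.2 h)
      obtain ⟨j, hj, hj0⟩ : ∃ z ∈ I⁻¹, z ≠ 0 := by
        by_contra! h
        exact hIi (FractionalIdeal.eq_zero_iff.2 h)
      obtain ⟨r, hr⟩ := (FractionalIdeal.mem_one_iff _).1 (hle (FractionalIdeal.mul_mem_mul hi hj))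
      have hx' : x ∈ completeIntegralClosure D (FractionRing D) := by
        refine ⟨r, mem_nonZeroDivisors_of_ne_zero ?_, fun n ↦ ?_⟩
        · rintro rfl
          rw [map_zero] at hr
          exact mul_ne_zero hi0 hj0 hr.symm
        · have := (FractionalIdeal.mem_inv_iff hI0).1 (hpow n j hj) i hi
          obtain ⟨d, hd⟩ := (FractionalIdeal.mem_one_iff _).1 this
          refine ⟨d, ?_⟩
          rw [hd, Algebra.smul_def, hr]
          ring
      rw [hD] at hx'
      obtain ⟨d, hd⟩ := Algebra.mem_bot.1 hx'
      exact (FractionalIdeal.mem_one_iff _).2 ⟨d, hd⟩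
    · exact FractionalIdeal.one_le.2 (one_mem_inv_of_le_one hII0 hle)
  rw [IsVInvertible, vClosure, key, inv_one]

/-! ### Discreteness of the localizations. -/

/-- A domain whose nonunits are the multiples of a nonunit `p ≠ 0` with `⋂ (p ^ n) = 0` is a
discrete valuation ring. -/
theorem isDiscreteValuationRing_of_forall_dvd {V : Type*} [CommRing V] [IsDomain V] {p : V}
    (hp0 : p ≠ 0) (hp : ¬ IsUnit p) (hmax : ∀ x : V, ¬ IsUnit x → p ∣ x)
    (harch : ∀ x : V, (∀ n, p ^ n ∣ x) → x = 0) : IsDiscreteValuationRing V := by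
  refine IsDiscreteValuationRing.ofHasUnitMulPowIrreducibleFactorization
    ⟨p, ⟨hp, fun {a b} hab ↦ ?_⟩, fun {x} hx ↦ ?_⟩
  · by_contra! h
    obtain ⟨c, rfl⟩ := hmax a h.1
    obtain ⟨d, rfl⟩ := hmax b h.2
    refine hp (.of_mul_eq_one (c * d) (mul_left_cancel₀ hp0 ?_))
    linear_combination -hab
  · have hex : ∃ n, ¬ p ^ n ∣ x := by
      by_contra! h
      exact hx (harch x h)
    classical
    obtain ⟨n, hn⟩ := Nat.exists_eq_succ_of_ne_zero
      (show Nat.find hex ≠ 0 from fun h ↦ Nat.find_spec hex (by simp [h]))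
    obtain ⟨y, hy⟩ : p ^ n ∣ x := not_not.1 (Nat.find_min hex (by omega))
    have hyu : IsUnit y := by
      by_contra hyu
      obtain ⟨z, rfl⟩ := hmax y hyu
      refine Nat.find_spec hex ⟨z, ?_⟩
      rw [hn, hy, pow_succ, mul_assoc]
    exact ⟨n, hyu.unit, by simp [hy]⟩

theorem algebraMap_notUnit_of_mem {D : Type*} [CommRing D] [IsDomain D] {P : PrimeSpectrum D}
    {d : D} (hd : d ∈ P.asIdeal) : ¬ IsUnit (algebraMap D (localizationAt P) d) := fun h ↦
  (IsLocalization.AtPrime.isUnit_to_map_iff (localizationAt P) P.asIdeal d).1 h hd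

/-- Distinct nonzero primes `P` and `Q` are not comparable if divisibility in `D_Q` is totally
ordered and archimedean. -/
theorem eq_of_le_of_archimedean {D : Type*} [CommRing D] [IsDomain D] {P Q : PrimeSpectrum D}
    (hP : P.asIdeal ≠ ⊥) (hPQ : P.asIdeal ≤ Q.asIdeal)
    (hV : ∀ x y : localizationAt Q, x ∣ y ∨ y ∣ x)
    (harch : ∀ p x : localizationAt Q, ¬ IsUnit p → (∀ n, p ^ n ∣ x) → x = 0) : P = Q := by
  refine PrimeSpectrum.ext (le_antisymm hPQ fun q hq ↦ ?_)
  by_contra hqP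
  obtain ⟨p, hp, hp0⟩ := Submodule.exists_mem_ne_zero_of_ne_bot hP
  have hinj : Function.Injective (algebraMap D (localizationAt Q)) :=
    IsLocalization.injective _ Q.asIdeal.primeCompl_le_nonZeroDivisors
  refine hp0 (hinj ?_)
  rw [map_zero]
  -- For `q ∈ Q` outside `P`, no `q ^ n` is a multiple of `p` in `D_Q`, since clearing denominators
  -- would put it in `P`. So every `q ^ n` divides `p`.
  refine harch _ _ (algebraMap_notUnit_of_mem hq) fun n ↦ ?_
  refine (hV _ _).resolve_right fun ⟨c, hc⟩ ↦ ?_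
  obtain ⟨r, t, rfl⟩ := IsLocalization.exists_mk'_eq Q.asIdeal.primeCompl c
  rw [← map_pow, IsLocalization.mul_mk'_eq_mk'_of_mul, IsLocalization.eq_mk'_iff_mul_eq,
    ← map_mul] at hc
  have hmem : q ^ n * (t : D) ∈ P.asIdeal := by
    rw [hinj hc]
    exact P.asIdeal.mul_mem_right _ hp
  rcases P.2.mem_or_mem hmem with h | h
  · exact hqP (P.2.mem_of_pow_mem _ h)
  · exact t.2 (hPQ h)

theorem exists_mem_inv_notMem_range {D : Type*} [CommRing D] [IsDomain D] {P : Ideal D}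
    (hPtop : P ≠ ⊤) (hP : IsDivisorial (P : FractionalIdeal D⁰ (FractionRing D))) :
    ∃ x ∈ (P : FractionalIdeal D⁰ (FractionRing D))⁻¹, x ∉ (⊥ : Subalgebra D (FractionRing D)) := by
  by_contra! h
  apply hPtop
  have h1 : (P : FractionalIdeal D⁰ (FractionRing D))⁻¹ = 1 := by
    refine le_antisymm (fun x hx ↦ ?_)
      (FractionalIdeal.one_le.2 (one_mem_inv_of_le_one hP.1 FractionalIdeal.coeIdeal_le_one))
    obtain ⟨d, hd⟩ := Algebra.mem_bot.1 (h x hx)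
    exact (FractionalIdeal.mem_one_iff _).2 ⟨d, hd⟩
  have h2 := hP.2
  rw [vClosure, h1, inv_one] at h2
  rw [FractionalIdeal.coeIdeal_eq_one.1 h2.symm, Ideal.one_eq_top]

theorem theorem1 {D : Type*} [CommRing D] [IsDomain D]
    (hD : IsIntersectionOfLocalizationsAtDivisorialPrimes D)
    (hX : IsPVMD (PowerSeries D)) :
    IsVDomain D ∧ IsIntersectionOfEssentialDVRs D ∧ IsCompletelyIntegrallyClosed D := by
  obtain ⟨F, hF, hbot⟩ := hD
  have hcmp (P) (hP : P ∈ F) := hX.exists_mul_eq_mul (isDivisorial_coeffIdeal (hF P hP))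
  have hV (P) (hP : P ∈ F) : ∀ x y : localizationAt P, x ∣ y ∨ y ∣ x :=
    dvd_or_dvd_of_coeffIdeal P.asIdeal (hcmp P hP)
  have harch (P) (hP : P ∈ F) : ∀ p x : localizationAt P, ¬ IsUnit p → (∀ n, p ^ n ∣ x) → x = 0 :=
    fun _ _ ↦ eq_zero_of_forall_pow_dvd_of_coeffIdeal P.asIdeal (hcmp P hP)
  have hCIC : IsCompletelyIntegrallyClosed D := by
    refine le_bot_iff.1 (hbot ▸ le_iInf₂ fun P hP x hx ↦ ?_)
    exact mem_of_isAlmostIntegral (hV P hP) (harch P hP) hx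
  refine ⟨hCIC.isVDomain, ⟨localizationAt '' F, ?_, by rw [sInf_image, hbot]⟩, hCIC⟩
  rintro _ ⟨P, hP, rfl⟩
  refine ⟨?_, P, rfl⟩
  have hPd := hF P hP
  have hPbot : P.asIdeal ≠ ⊥ := FractionalIdeal.coeIdeal_ne_zero.1 hPd.1
  obtain ⟨x, hxP, hxD⟩ := exists_mem_inv_notMem_range P.2.ne_top hPd
  have hxmul : ∀ p ∈ P.asIdeal, ∃ d : D, algebraMap D (FractionRing D) d = x * algebraMap D _ p :=
    fun p hp ↦ (FractionalIdeal.mem_one_iff _).1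
      ((FractionalIdeal.mem_inv_iff hPd.1).1 hxP _ (FractionalIdeal.mem_coeIdeal_of_mem _ hp))
  have hxV : x ∉ localizationAt P := by
    intro hxV
    rw [← hbot] at hxD
    simp only [Algebra.mem_iInf, not_forall] at hxD
    obtain ⟨Q, hQ, hxQ⟩ := hxD
    -- Since `x ∉ D_Q`, its inverse `y` is a nonunit of `D_Q`, and `p = y * (x p)` with `x p ∈ D`
    -- puts `p` in `Q`.
    suffices hPQ : P.asIdeal ≤ Q.asIdeal by
      rw [eq_of_le_of_archimedean hPbot hPQ (hV Q hQ) (harch Q hQ)] at hxV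
      exact hxQ hxV
    intro p hp
    obtain ⟨d, hd⟩ := hxmul p hp
    obtain ⟨y, hyu, hyx⟩ := exists_mul_eq_one_of_notMem (hV Q hQ) hxQ
    refine mem_of_dvd_algebraMap Q.asIdeal hyu ⟨algebraMap D _ d, Subtype.ext ?_⟩
    change algebraMap D (FractionRing D) p = y * algebraMap D _ d
    rw [hd, ← mul_assoc, hyx, one_mul]
  obtain ⟨y, hyu, hyx⟩ := exists_mul_eq_one_of_notMem (hV P hP) hxV
  -- The uniformizer is `y = 1 / x`: a nonunit is associated to some `p ∈ P`, and `p = y * (x p)`.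
  refine isDiscreteValuationRing_of_forall_dvd (p := y) ?_ hyu (fun z hz ↦ ?_)
    fun z ↦ harch P hP y z hyu
  · rintro rfl
    simp at hyx
  · obtain ⟨p, hp⟩ := exists_associated_algebraMap P.asIdeal z
    have hpP : p ∈ P.asIdeal := by
      by_contra h
      exact hz (hp.isUnit
        ((IsLocalization.AtPrime.isUnit_to_map_iff (localizationAt P) P.asIdeal p).2 h))
    obtain ⟨d, hd⟩ := hxmul p hpP
    refine hp.dvd_iff_dvd_right.1 ⟨algebraMap D _ d, Subtype.ext ?_⟩
    change algebraMap D (FractionRing D) p = y * algebraMap D _ d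
    rw [hd, ← mul_assoc, hyx, one_mul]
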